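/- Let $d\in\{2,3\}$, let $\Omega\subset\mathbb{R}^d$ be a bounded domain, let $-1/3\le\alpha\le 1000$, and let $k$ be a bounded measurable function on $\Omega$ with $k(x)\ge k_*\ge 0$ for all $x\in\Omega$. With $\epsilon(\mathbf u)=\tfrac12(\nabla\mathbf u+(\nabla\mathbf u)^T)$ put $$a(\mathbf u,\mathbf v)=\int_\Omega \epsilon(\mathbf u):\epsilon(\mathbf v)+\alpha(\nabla\cdot\mathbf u)(\nabla\cdot\mathbf v)\,dx,\qquad b(p,\mathbf v)=-\int_\Omega p\,\nabla\cdot\mathbf v\,dx,\qquad c(p,q)=\int_\Omega k\,\nabla p\cdot\nabla q\,dx .$$ Let $\mathbf X_h\subset (H^1_0(\Omega))^d$ and $M_h\subset H^1(\Omega)\cap L^2_0(\Omega)$ be finite-dimensional (finite element) spaces, where $L^2_0(\Omega)$ denotes the zero-mean functions in $L^2(\Omega)$. Assume that they are inf-sup stable with constant $c_1>0$: $\max_{0\neq\mathbf v\in\mathbf X_h} b(q,\mathbf v)/\|\nabla\mathbf v\|\ge c_1\|q\|$ for all $0\ne q\in M_h$. Let $c_P>0$ be a Poincaré constant of $\Omega$: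 $c_P\|q\|^2\le\|\nabla q\|^2$ for all $q\in H^1(\Omega)\cap L^2_0(\Omega)$. Fix bases of $\mathbf X_h$ and $M_h$, with $n_u=\dim \mathbf X_h$ and $n_p=\dim M_h$, and let $A\in\mathbb{R}^{n_u\times n_u}$, $B\in\mathbb{R}^{n_p\times n_u}$, $C_k\in\mathbb{R}^{n_p\times n_p}$ be the matrices of $a$, $b$, $c$, and $Q\in\mathbb{R}^{n_p\times n_p}$ the mass matrix (the $L^2$ Gram matrix) of $M_h$, in these bases. Let $P\in\mathbb{R}^{n_u\times n_u}$ and $T\in\mathbb{R}^{n_p\times n_p}$ be symmetric positive definite and suppose that, with positive constants $\delta_{AP},\delta^{AP},\delta_{QT},\delta^{QT}$, $$\delta_{AP}\le\frac{\langle Av,v\rangle}{\langle Pv,v\rangle}\le\delta^{AP}\quad(0\ne v\in\mathbb{R}^{n_u}),\qquad \delta_{QT}\le\frac{\langle (Q+C_k)q,q\rangle}{\langle Tq,q\rangle}\le\delta^{QT}\quad(0\ne q\in\mathbb{R}^{n_p}).$$ Set $$c^q=\begin{cases}1/(1-|\alpha|),&-1/3\le\alpha<0,\\ 1,&\alpha\ge0,\end{cases}\qquad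 c_q=\min\left(\frac{c_1^2+c_Pk_*(1+|\alpha|)}{(1+|\alpha|)(1+c_Pk_*)},\,1\right),$$ $$\mathcal K=\begin{bmatrix}A&B^T\\B&-C_k\end{bmatrix},\qquad \mathcal P=\begin{bmatrix}P&0\\0&T\end{bmatrix}.$$ (i) Every eigenvalue $\lambda<0$ of the generalised eigenproblem $\mathcal K x=\lambda\mathcal P x$ satisfies $$-c^q\delta^{QT}\le\lambda\le\tfrac12\left(\delta_{AP}-\sqrt{\delta_{AP}^2+4c_q\delta_{QT}\delta_{AP}}\right),$$ and every eigenvalue $\lambda>0$ satisfies $$\delta_{AP}\le\lambda\le\delta^{AP}+c^q\delta^{QT}.$$ (ii) Consequently, MINRES preconditioned by $\mathcal P$ is optimal. For every tolerance $\tau>0$ there is an $N\in\mathbb{N}$, depending only on $\tau,\alpha,k_*,c_1,c_P,\delta_{AP},\delta^{AP},\delta_{QT},\delta^{QT}$ (in particular not on the discretisation or its dimension), such that for every right-hand side $f$, every initial guess $x_0$ and every $m\ge N$, the $m$-th iterate $x_m$ satisfies $\|f-\mathcal Kx_m\|_{\mathcal P^{-1}}\le\tau\,\|f-\mathcal Kx_0\|_{\mathcal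 P^{-1}}$. Here $\|r\|_{\mathcal P^{-1}}=\langle\mathcal P^{-1}r,r\rangle^{1/2}$, and $x_m$ is the minimiser of $\|f-\mathcal Kx\|_{\mathcal P^{-1}}$ over $x\in x_0+\operatorname{span}\{(\mathcal P^{-1}\mathcal K)^j\mathcal P^{-1}(f-\mathcal Kx_0):0\le j<m\}$. -/

import Mathlib

namespace MagmaMantle

open MeasureTheory
open scoped ContDiff Matrix

/-- Physical space `ℝ^d`. -/
abbrev Space (d : ℕ) : Type := EuclideanSpace ℝ (Fin d)

/-- The real Hilbert space `L²(Ω)`; its inner product is `inner ℝ f g = ∫_Ω f g`. -/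
abbrev L2 {d : ℕ} (Ω : Set (Space d)) : Type := Lp ℝ 2 (volume.restrict Ω)

/-- A scalar `L²` function together with `d` further `L²` functions. An element `q` of `H¹(Ω)` is
represented by the pair `(q, ∇q)`, see `MemH1`: `q.1` is the function, `q.2 j` is `∂_j q`. -/
abbrev FieldPair {d : ℕ} (Ω : Set (Space d)) : Type := L2 Ω × (Fin d → L2 Ω)

/-- Vector fields, by components: `(v i).1` is `v_i` and `(v i).2 j` is `∂_j v_i`. -/
abbrev VectorField {d : ℕ} (Ω : Set (Space d)) : Type := Fin d → FieldPair Ω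

/-- The partial derivative `∂_i φ` of a differentiable function. -/
noncomputable def pderiv {d : ℕ} (i : Fin d) (φ : Space d → ℝ) (x : Space d) : ℝ :=
  fderiv ℝ φ x (EuclideanSpace.single i 1)

/-- Test functions: `φ ∈ C_c^∞(Ω)`. -/
structure IsTestFunction {d : ℕ} (Ω : Set (Space d)) (φ : Space d → ℝ) : Prop where
  smooth : ContDiff ℝ ∞ φ
  compact : HasCompactSupport φ
  support : tsupport φ ⊆ Ω

/-- `q.1 ∈ H¹(Ω)` with weak gradient `q.2`. -/
def MemH1 {d : ℕ} {Ω : Set (Space d)} (q : FieldPair Ω) : Prop :=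
  ∀ φ : Space d → ℝ, IsTestFunction Ω φ → ∀ i : Fin d,
    ∫ x in Ω, q.1 x * pderiv i φ x = - ∫ x in Ω, q.2 i x * φ x

/-- `H¹₀(Ω)`: the closure of `C_c^∞(Ω)` in the `H¹` topology, as a space of pairs `(u, ∇u)`. -/
noncomputable def H10 {d : ℕ} (Ω : Set (Space d)) : Submodule ℝ (FieldPair Ω) :=
  (Submodule.span ℝ {w : FieldPair Ω | ∃ φ : Space d → ℝ, IsTestFunction Ω φ ∧
    (w.1 =ᵐ[volume.restrict Ω] φ) ∧
    ∀ i : Fin d, w.2 i =ᵐ[volume.restrict Ω] pderiv i φ}).topologicalClosure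

/-- `q.1 ∈ L²₀(Ω)`: zero mean. -/
def ZeroMean {d : ℕ} {Ω : Set (Space d)} (q : FieldPair Ω) : Prop :=
  ∫ x in Ω, q.1 x = 0

/-- `‖∇q‖²` for a scalar field. -/
noncomputable def gradNormSq {d : ℕ} {Ω : Set (Space d)} (q : FieldPair Ω) : ℝ :=
  ∑ j, ‖q.2 j‖ ^ 2

/-- `‖∇v‖²` for a vector field. -/
noncomputable def vecGradNormSq {d : ℕ} {Ω : Set (Space d)} (v : VectorField Ω) : ℝ :=
  ∑ i, gradNormSq (v i)

/-- The divergence `∇ · v`. -/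
noncomputable def divergence {d : ℕ} {Ω : Set (Space d)} (v : VectorField Ω) : L2 Ω :=
  ∑ i, (v i).2 i

/-- The entries of the strain rate tensor `(∇v + (∇v)ᵀ) / 2`. -/
noncomputable def strain {d : ℕ} {Ω : Set (Space d)} (v : VectorField Ω) (i j : Fin d) : L2 Ω :=
  (2⁻¹ : ℝ) • ((v i).2 j + (v j).2 i)

/-- `a(u, v) = ∫_Ω ε(u) : ε(v) + α (∇ · u) (∇ · v)`. -/
noncomputable def aForm {d : ℕ} {Ω : Set (Space d)} (α : ℝ) (u v : VectorField Ω) : ℝ :=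
  (∑ i, ∑ j, inner ℝ (strain u i j) (strain v i j)) + α * inner ℝ (divergence u) (divergence v)

/-- `b(p, v) = - ∫_Ω p ∇ · v`. -/
noncomputable def bForm {d : ℕ} {Ω : Set (Space d)} (p : FieldPair Ω) (v : VectorField Ω) : ℝ :=
  - inner ℝ p.1 (divergence v)

/-- `c(p, q) = ∫_Ω k ∇p · ∇q`. -/
noncomputable def cForm {d : ℕ} {Ω : Set (Space d)} (k : Space d → ℝ) (p q : FieldPair Ω) : ℝ :=
  ∫ x in Ω, k x * ∑ j, p.2 j x * q.2 j x

/-- A conforming finite element discretisation: a bounded domain `Ω ⊂ ℝ^d`, a bounded nonnegative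
coefficient `k`, finite-dimensional spaces `X_h ⊂ H¹₀(Ω)^d` and `M_h ⊂ H¹(Ω) ∩ L²₀(Ω)`, and a basis
of each of them. -/
structure Discretisation (d : ℕ) where
  Ω : Set (Space d)
  isOpen : IsOpen Ω
  isConnected : IsConnected Ω
  isBounded : Bornology.IsBounded Ω
  k : Space d → ℝ
  k_measurable : AEStronglyMeasurable k (volume.restrict Ω)
  k_nonneg : ∀ x ∈ Ω, 0 ≤ k x
  k_bounded : ∃ kUp : ℝ, ∀ x ∈ Ω, k x ≤ kUp
  X : Submodule ℝ (VectorField Ω)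
  M : Submodule ℝ (FieldPair Ω)
  X_le : ∀ v ∈ X, ∀ i, v i ∈ H10 Ω
  M_le : ∀ q ∈ M, MemH1 q ∧ ZeroMean q
  nu : ℕ
  np : ℕ
  basisX : Module.Basis (Fin nu) ℝ X
  basisM : Module.Basis (Fin np) ℝ M

namespace Discretisation

variable {d : ℕ} (D : Discretisation d)

/-- The inf-sup condition `max_{v ∈ X_h} b(q, v) / ‖∇v‖ ≥ c₁ ‖q‖` for all `q ∈ M_h`. -/
def InfSup (c₁ : ℝ) : Prop :=
  ∀ q ∈ D.M, q ≠ 0 → ∃ v ∈ D.X, v ≠ 0 ∧ c₁ * ‖q.1‖ * √(vecGradNormSq v) ≤ bForm q v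

/-- `cP` is a Poincaré constant of the domain: `cP ‖q‖² ≤ ‖∇q‖²` on `H¹(Ω) ∩ L²₀(Ω)`. -/
def Poincare (cP : ℝ) : Prop :=
  ∀ q : FieldPair D.Ω, MemH1 q → ZeroMean q → cP * ‖q.1‖ ^ 2 ≤ gradNormSq q

/-- The matrix `A` of the form `a`. -/
noncomputable def A (α : ℝ) : Matrix (Fin D.nu) (Fin D.nu) ℝ :=
  Matrix.of fun i j => aForm α (D.basisX i : VectorField D.Ω) (D.basisX j)

/-- The matrix `B` of the form `b`. -/
noncomputable def B : Matrix (Fin D.np) (Fin D.nu) ℝ :=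
  Matrix.of fun i j => bForm (D.basisM i : FieldPair D.Ω) (D.basisX j : VectorField D.Ω)

/-- The matrix `C_k` of the form `c`. -/
noncomputable def C : Matrix (Fin D.np) (Fin D.np) ℝ :=
  Matrix.of fun i j => cForm D.k (D.basisM i : FieldPair D.Ω) (D.basisM j)

/-- The pressure mass matrix `Q`. -/
noncomputable def Q : Matrix (Fin D.np) (Fin D.np) ℝ :=
  Matrix.of fun i j => inner ℝ (D.basisM i : FieldPair D.Ω).1 (D.basisM j : FieldPair D.Ω).1

/-- The saddle-point matrix `[[A, Bᵀ], [B, -C_k]]`. -/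
noncomputable def saddle (α : ℝ) : Matrix (Fin D.nu ⊕ Fin D.np) (Fin D.nu ⊕ Fin D.np) ℝ :=
  Matrix.fromBlocks (D.A α) D.Bᵀ D.B (-D.C)

end Discretisation

/-- The block diagonal preconditioner `diag(P, T)`. -/
def blockPrec {n m : ℕ} (P : Matrix (Fin n) (Fin n) ℝ) (T : Matrix (Fin m) (Fin m) ℝ) :
    Matrix (Fin n ⊕ Fin m) (Fin n ⊕ Fin m) ℝ :=
  Matrix.fromBlocks P 0 0 T

/-- `lo ≤ ⟨Y v, v⟩ / ⟨Z v, v⟩ ≤ up` for all `v ≠ 0`. -/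
def SpectralBounds {n : ℕ} (Y Z : Matrix (Fin n) (Fin n) ℝ) (lo up : ℝ) : Prop :=
  ∀ v : Fin n → ℝ, v ≠ 0 →
    lo ≤ (v ⬝ᵥ (Y *ᵥ v)) / (v ⬝ᵥ (Z *ᵥ v)) ∧ (v ⬝ᵥ (Y *ᵥ v)) / (v ⬝ᵥ (Z *ᵥ v)) ≤ up

/-- `lam` is an eigenvalue of the generalised eigenproblem `K x = lam Z x`. -/
def IsGenEigenvalue {ι : Type*} [Fintype ι] (K Z : Matrix ι ι ℝ) (lam : ℝ) : Prop :=
  ∃ x : ι → ℝ, x ≠ 0 ∧ K *ᵥ x = lam • (Z *ᵥ x)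

/-- The constant `c^q`. -/
noncomputable def cUpper (α : ℝ) : ℝ := if α < 0 then 1 / (1 - |α|) else 1

/-- The constant `c_q`. -/
noncomputable def cLower (α kLow c₁ cP : ℝ) : ℝ :=
  min ((c₁ ^ 2 + cP * kLow * (1 + |α|)) / ((1 + |α|) * (1 + cP * kLow))) 1

/-- The norm `‖r‖_{Z⁻¹} = √⟨Z⁻¹ r, r⟩`. -/
noncomputable def precNorm {ι : Type*} [Fintype ι] [DecidableEq ι] (Z : Matrix ι ι ℝ)
    (r : ι → ℝ) : ℝ :=
  √(r ⬝ᵥ (Z⁻¹ *ᵥ r))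

/-- The Krylov space `span {(Z⁻¹ K)^j Z⁻¹ r | 0 ≤ j < m}`. -/
noncomputable def krylov {ι : Type*} [Fintype ι] [DecidableEq ι] (K Z : Matrix ι ι ℝ)
    (r : ι → ℝ) (m : ℕ) : Submodule ℝ (ι → ℝ) :=
  Submodule.span ℝ (Set.range fun j : Fin m => ((Z⁻¹ * K) ^ (j : ℕ)) *ᵥ (Z⁻¹ *ᵥ r))

/-- `x` is the `m`-th iterate of MINRES for `K x = f`, preconditioned by the symmetric positive
definite matrix `Z` and started from `x₀`: it minimises the `Z⁻¹`-norm of the residual over `x₀`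
plus the `m`-th Krylov space. -/
structure IsMinresIterate {ι : Type*} [Fintype ι] [DecidableEq ι] (K Z : Matrix ι ι ℝ)
    (f x₀ : ι → ℝ) (m : ℕ) (x : ι → ℝ) : Prop where
  mem : x - x₀ ∈ krylov K Z (f - K *ᵥ x₀) m
  minimal : ∀ y : ι → ℝ, y - x₀ ∈ krylov K Z (f - K *ᵥ x₀) m →
    precNorm Z (f - K *ᵥ x) ≤ precNorm Z (f - K *ᵥ y)

/-- The standing hypotheses relating a discretisation and the blocks `P`, `T` of a preconditioner
to the constants in the eigenvalue bounds. -/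
structure Admissible {d : ℕ} (D : Discretisation d) (α kLow c₁ cP : ℝ)
    (P : Matrix (Fin D.nu) (Fin D.nu) ℝ) (T : Matrix (Fin D.np) (Fin D.np) ℝ)
    (lowAP upAP lowQT upQT : ℝ) : Prop where
  k_low : ∀ x ∈ D.Ω, kLow ≤ D.k x
  infSup : D.InfSup c₁
  poincare : D.Poincare cP
  P_posDef : P.PosDef
  T_posDef : T.PosDef
  boundsAP : SpectralBounds (D.A α) P lowAP upAP
  boundsQT : SpectralBounds (D.Q + D.C) T lowQT upQT

end MagmaMantle

open MagmaMantle
open scoped Matrix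

/-!
The eigenvalue bounds come from testing the eigenproblem with the eigenvector. For an eigenvector
`(u, p)` with eigenvalue `lam`, the two block rows read
`⟨A u, u⟩ + ⟨B u, p⟩ = lam ⟨P u, u⟩` and `⟨B u, p⟩ - ⟨C p, p⟩ = lam ⟨T p, p⟩`, and all bounds but
one follow from these two scalar identities and the following estimates on the blocks.

* On `H¹₀(Ω)^d` partial derivatives may be interchanged in `∫ ∂_i v_i ∂_j v_j`
  (`inner_snd_comm_of_mem_H10`), so that `‖ε(v)‖² = (‖∇v‖² + ‖∇ · v‖²) / 2` and
  `‖∇ · v‖ ≤ ‖∇v‖`. Hence `‖∇ · v‖² ≤ c^q a(v, v)` and `a(v, v) ≤ (1 + |α|) ‖∇v‖²`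
  (`norm_divergence_sq_le_aForm`, `aForm_self_le`), which turn the continuity and the inf-sup
  stability of `b` into statements about the norms of `Q` and `A`.
* The Poincaré inequality gives `C ≥ c_P k_* Q`, and `c_q` is chosen such that
  `c_q (Q + C) ≤ c₁² / (1 + |α|) Q + C` (`SaddleBounds.schur_total_lower`).

The bound away from zero on the negative eigenvalues is the only one that needs a test vector other
than `(u, p)`: the velocity from the inf-sup condition for `p`, used in the Cauchy–Schwarz
inequality for the positive form `A - lam P ≤ (1 - lam / δ_AP) A` (`SaddleBounds.schur_lower`).
It leads to a quadratic inequality for `lam`. The same argument excludes the eigenvalue `0`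
(`SaddleBounds.ne_zero`).

So the moduli of all eigenvalues lie in an interval `[lo, up]`, with `0 < lo`, that depends on the
constants only. With `Z = b²` and `s = b⁻¹`, residuals evolve under MINRES by polynomials in the
Hermitian matrix `s K s`, and the competitor `(1 - t² / up²)^k`, of degree `2 k`, shows that `2 k`
steps reduce the residual at least by the factor `(1 - lo² / up²)^k`
(`IsMinresIterate.precNorm_le`).
-/

open MagmaMantle
open scoped Matrix

namespace MagmaMantle

open MeasureTheory
open scoped ContDiff

/-! ### Korn's identity on `H¹₀(Ω)` -/

section Korn

variable {d : ℕ} {Ω : Set (Space d)}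

lemma IsTestFunction.contDiff_pderiv {φ : Space d → ℝ} (h : IsTestFunction Ω φ) (i : Fin d) :
    ContDiff ℝ ∞ (pderiv i φ) :=
  (h.smooth.fderiv_right (m := ∞) (by simp)).clm_apply contDiff_const

lemma IsTestFunction.hasCompactSupport_pderiv {φ : Space d → ℝ} (h : IsTestFunction Ω φ)
    (i : Fin d) : HasCompactSupport (pderiv i φ) :=
  h.compact.fderiv_apply (𝕜 := ℝ) _

lemma IsTestFunction.pderiv_comm {φ : Space d → ℝ} (h : IsTestFunction Ω φ) (i j : Fin d) :
    pderiv i (pderiv j φ) = pderiv j (pderiv i φ) := by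
  have hd : Differentiable ℝ (fderiv ℝ φ) :=
    (h.smooth.fderiv_right (m := ∞) (by simp)).differentiable (by simp)
  funext x
  have key (a b : Fin d) : pderiv a (pderiv b φ) x =
      fderiv ℝ (fderiv ℝ φ) x (EuclideanSpace.single a 1) (EuclideanSpace.single b 1) := by
    change fderiv ℝ (fun y => fderiv ℝ φ y (EuclideanSpace.single b 1)) x
      (EuclideanSpace.single a 1) = _
    rw [fderiv_clm_apply (hd x) (differentiableAt_const _)]
    simp
  rw [key, key]
  exact (h.smooth.contDiffAt.isSymmSndFDerivAt (by
    rw [minSmoothness_of_isRCLikeNormedField]; exact WithTop.coe_le_coe.2 le_top)) _ _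

/-- Both sides are `-∫ φ ∂_i ∂_j ψ`, by integration by parts. -/
lemma integral_pderiv_mul_pderiv_comm {φ ψ : Space d → ℝ} (hφ : IsTestFunction Ω φ)
    (hψ : IsTestFunction Ω ψ) (i j : Fin d) :
    ∫ x, pderiv i φ x * pderiv j ψ x = ∫ x, pderiv j φ x * pderiv i ψ x := by
  have parts (a b : Fin d) :
      ∫ x, pderiv a φ x * pderiv b ψ x = - ∫ x, φ x * pderiv a (pderiv b ψ) x := by
    have hb := hψ.contDiff_pderiv b
    have hab : Continuous (pderiv a (pderiv b ψ)) :=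
      ((hb.fderiv_right (m := ∞) (by simp)).clm_apply contDiff_const).continuous
    have h := integral_mul_fderiv_eq_neg_fderiv_mul_of_integrable (μ := volume)
      (v := EuclideanSpace.single a (1 : ℝ)) (f := φ) (g := pderiv b ψ)
      (((hφ.contDiff_pderiv a).continuous.mul hb.continuous).integrable_of_hasCompactSupport
        (hφ.hasCompactSupport_pderiv a).mul_right)
      ((hφ.smooth.continuous.mul hab).integrable_of_hasCompactSupport hφ.compact.mul_right)
      ((hφ.smooth.continuous.mul hb.continuous).integrable_of_hasCompactSupport
        hφ.compact.mul_right)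
      (fun x _ => (hφ.smooth.differentiable (by simp)) x)
      (fun x _ => (hb.differentiable (by simp)) x)
    change ∫ x, φ x * pderiv a (pderiv b ψ) x = - ∫ x, pderiv a φ x * pderiv b ψ x at h
    rw [h, neg_neg]
  rw [parts, parts, hψ.pderiv_comm]

lemma setIntegral_pderiv_mul {φ ψ : Space d → ℝ} (hφ : IsTestFunction Ω φ) (i j : Fin d) :
    ∫ x in Ω, pderiv i φ x * pderiv j ψ x = ∫ x, pderiv i φ x * pderiv j ψ x := by
  refine setIntegral_eq_integral_of_forall_compl_eq_zero fun x hx => ?_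
  have : fderiv ℝ φ x = 0 := by
    by_contra h
    exact hx (hφ.support (support_fderiv_subset ℝ (f := φ) h))
  simp [pderiv, this]

/-- Elements of `H¹₀(Ω)` have vanishing boundary values, so that two partial derivatives may be
interchanged in the inner product; this is passed from test functions to the closure. -/
lemma inner_snd_comm_of_mem_H10 {w z : FieldPair Ω} (hw : w ∈ H10 Ω) (hz : z ∈ H10 Ω)
    (i j : Fin d) : (inner ℝ (w.2 i) (z.2 j) : ℝ) = inner ℝ (w.2 j) (z.2 i) := by
  let S : Set (FieldPair Ω) := {w | ∃ φ : Space d → ℝ, IsTestFunction Ω φ ∧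
    (w.1 =ᵐ[volume.restrict Ω] φ) ∧ ∀ i : Fin d, w.2 i =ᵐ[volume.restrict Ω] pderiv i φ}
  have hSS (w z : FieldPair Ω) (hw : w ∈ S) (hz : z ∈ S) :
      (inner ℝ (w.2 i) (z.2 j) : ℝ) = inner ℝ (w.2 j) (z.2 i) := by
    obtain ⟨φ, hφ, -, hφ'⟩ := hw
    obtain ⟨ψ, hψ, -, hψ'⟩ := hz
    have key (a b : Fin d) : (inner ℝ (w.2 a) (z.2 b) : ℝ) =
        ∫ x, pderiv a φ x * pderiv b ψ x := by
      rw [← setIntegral_pderiv_mul hφ, L2.inner_def]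
      refine integral_congr_ae ?_
      filter_upwards [hφ' a, hψ' b] with x h1 h2
      simp [h1, h2, mul_comm]
    rw [key, key, integral_pderiv_mul_pderiv_comm hφ hψ]
  have comp (a : Fin d) : Continuous fun w : FieldPair Ω => w.2 a :=
    (continuous_apply a).comp continuous_snd
  -- For a fixed second argument the identity defines a closed subspace.
  let V (z : FieldPair Ω) : Submodule ℝ (FieldPair Ω) :=
    { carrier := {w | (inner ℝ (w.2 i) (z.2 j) : ℝ) = inner ℝ (w.2 j) (z.2 i)}
      add_mem' := fun {a b} ha hb => by
        simp only [Set.mem_ofPred_eq] at ha hb ⊢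
        simp [inner_add_left, ha, hb]
      zero_mem' := by simp
      smul_mem' := fun c a ha => by
        simp only [Set.mem_ofPred_eq] at ha ⊢
        simp [real_inner_smul_left, ha] }
  have hV (z : FieldPair Ω) (h : S ⊆ V z) : H10 Ω ≤ V z :=
    Submodule.topologicalClosure_minimal _ (Submodule.span_le.2 h)
      (isClosed_eq ((comp i).inner continuous_const) ((comp j).inner continuous_const))
  let V' (w : FieldPair Ω) : Submodule ℝ (FieldPair Ω) :=
    { carrier := {z | (inner ℝ (w.2 i) (z.2 j) : ℝ) = inner ℝ (w.2 j) (z.2 i)}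
      add_mem' := fun {a b} ha hb => by
        simp only [Set.mem_ofPred_eq] at ha hb ⊢
        simp [inner_add_right, ha, hb]
      zero_mem' := by simp
      smul_mem' := fun c a ha => by
        simp only [Set.mem_ofPred_eq] at ha ⊢
        simp [real_inner_smul_right, ha] }
  have hV' : H10 Ω ≤ V' w :=
    Submodule.topologicalClosure_minimal _
      (Submodule.span_le.2 fun z hz => hV z (fun w hw => hSS w z hw hz) hw)
      (isClosed_eq (continuous_const.inner (comp j)) (continuous_const.inner (comp i)))
  exact hV' hz

variable {v : VectorField Ω}

lemma norm_divergence_sq (hv : ∀ i, v i ∈ H10 Ω) :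
    ‖divergence v‖ ^ 2 = ∑ i, ∑ j, (inner ℝ ((v i).2 j) ((v j).2 i) : ℝ) := by
  rw [← real_inner_self_eq_norm_sq, divergence, sum_inner]
  refine Finset.sum_congr rfl fun i _ => ?_
  rw [inner_sum]
  exact Finset.sum_congr rfl fun j _ => inner_snd_comm_of_mem_H10 (hv i) (hv j) i j

lemma vecGradNormSq_eq_sum (v : VectorField Ω) :
    vecGradNormSq v = ∑ i, ∑ j, ‖(v i).2 j‖ ^ 2 := rfl

lemma vecGradNormSq_eq_sum_swap (v : VectorField Ω) :
    vecGradNormSq v = ∑ i, ∑ j, ‖(v j).2 i‖ ^ 2 := by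
  rw [vecGradNormSq_eq_sum, Finset.sum_comm]

/-- Korn's identity: `‖ε(v)‖² = (‖∇v‖² + ‖∇ · v‖²) / 2`. -/
lemma sum_norm_strain_sq (hv : ∀ i, v i ∈ H10 Ω) :
    ∑ i, ∑ j, ‖strain v i j‖ ^ 2 = (vecGradNormSq v + ‖divergence v‖ ^ 2) / 2 := by
  have h (i j : Fin d) : ‖strain v i j‖ ^ 2 = (1 / 4) * ‖(v i).2 j‖ ^ 2 +
      (1 / 4) * ‖(v j).2 i‖ ^ 2 + (1 / 2) * inner ℝ ((v i).2 j) ((v j).2 i) := by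
    rw [strain, norm_smul, mul_pow, norm_add_sq_real]
    norm_num
    ring
  simp_rw [h, Finset.sum_add_distrib, ← Finset.mul_sum]
  rw [← norm_divergence_sq hv, ← vecGradNormSq_eq_sum, ← vecGradNormSq_eq_sum_swap]
  ring

/-- The difference of the two sides is the squared norm of the rotation of `v`. -/
lemma norm_divergence_sq_le (hv : ∀ i, v i ∈ H10 Ω) :
    ‖divergence v‖ ^ 2 ≤ vecGradNormSq v := by
  have h0 : 0 ≤ ∑ i, ∑ j, ‖(v i).2 j - (v j).2 i‖ ^ 2 := by positivity
  simp_rw [norm_sub_sq_real, Finset.sum_add_distrib, Finset.sum_sub_distrib,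
    ← Finset.mul_sum] at h0
  rw [← norm_divergence_sq hv, ← vecGradNormSq_eq_sum, ← vecGradNormSq_eq_sum_swap] at h0
  linarith

lemma aForm_self (α : ℝ) (hv : ∀ i, v i ∈ H10 Ω) :
    aForm α v v = vecGradNormSq v / 2 + (1 / 2 + α) * ‖divergence v‖ ^ 2 := by
  simp_rw [aForm, real_inner_self_eq_norm_sq]
  rw [sum_norm_strain_sq hv]
  ring

lemma aForm_self_le (α : ℝ) (hv : ∀ i, v i ∈ H10 Ω) :
    aForm α v v ≤ (1 + |α|) * vecGradNormSq v := by
  have h1 := norm_divergence_sq_le hv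
  have h2 : α * ‖divergence v‖ ^ 2 ≤ |α| * vecGradNormSq v :=
    (mul_le_mul_of_nonneg_right (le_abs_self α) (sq_nonneg _)).trans
      (mul_le_mul_of_nonneg_left h1 (abs_nonneg α))
  rw [aForm_self α hv]
  linarith

lemma norm_divergence_sq_le_aForm {α : ℝ} (hα : -1 < α) (hv : ∀ i, v i ∈ H10 Ω) :
    ‖divergence v‖ ^ 2 ≤ cUpper α * aForm α v v := by
  have h1 := norm_divergence_sq_le hv
  have h2 : (1 + α) * ‖divergence v‖ ^ 2 ≤ aForm α v v := by
    rw [aForm_self α hv]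
    linarith
  unfold cUpper
  split_ifs with hneg
  · rw [abs_of_neg hneg, sub_neg_eq_add, one_div_mul_eq_div, le_div_iff₀ (by linarith)]
    linarith
  · nlinarith [sq_nonneg ‖divergence v‖]

lemma one_le_cUpper {α : ℝ} (hα : -1 < α) : 1 ≤ cUpper α := by
  unfold cUpper
  split_ifs with hneg
  · rw [abs_of_neg hneg, le_div_iff₀ (by linarith)]
    linarith
  · exact le_rfl

lemma bForm_sq_le {α : ℝ} (hα : -1 < α) (q : FieldPair Ω) (hv : ∀ i, v i ∈ H10 Ω) :
    bForm q v ^ 2 ≤ cUpper α * ‖q.1‖ ^ 2 * aForm α v v := by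
  have h1 : bForm q v ^ 2 ≤ ‖q.1‖ ^ 2 * ‖divergence v‖ ^ 2 := by
    rw [bForm, neg_sq, ← mul_pow]
    exact sq_le_sq' (neg_le_of_abs_le (abs_real_inner_le_norm _ _)) (real_inner_le_norm _ _)
  have h2 := mul_le_mul_of_nonneg_left (norm_divergence_sq_le_aForm hα hv) (sq_nonneg ‖q.1‖)
  linarith

end Korn

/-! ### The weighted Dirichlet form -/

section Dirichlet

variable {d : ℕ} {Ω : Set (Space d)} {k : Space d → ℝ}

/-- The conditions on the coefficient that make `cForm k` a bounded nonnegative form. -/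
structure IsCoefficient (Ω : Set (Space d)) (k : Space d → ℝ) : Prop where
  measurableSet : MeasurableSet Ω
  aestronglyMeasurable : AEStronglyMeasurable k (volume.restrict Ω)
  nonneg : ∀ x ∈ Ω, 0 ≤ k x
  bounded : ∃ c : ℝ, ∀ x ∈ Ω, k x ≤ c

lemma integrable_mul_L2 (f g : L2 Ω) :
    Integrable (fun x => f x * g x) (volume.restrict Ω) := by
  simpa [mul_comm] using L2.integrable_inner (𝕜 := ℝ) f g

lemma inner_L2_eq (f g : L2 Ω) : (inner ℝ f g : ℝ) = ∫ x in Ω, f x * g x := by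
  simp [L2.inner_def, mul_comm]

lemma IsCoefficient.integrable_mul (hk : IsCoefficient Ω k) (f g : L2 Ω) :
    Integrable (fun x => k x * (f x * g x)) (volume.restrict Ω) := by
  obtain ⟨c, hc⟩ := hk.bounded
  refine (integrable_mul_L2 f g).bdd_mul (c := c) hk.aestronglyMeasurable ?_
  filter_upwards [ae_restrict_mem hk.measurableSet] with x hx
  rw [Real.norm_of_nonneg (hk.nonneg x hx)]
  exact hc x hx

lemma IsCoefficient.cForm_eq_sum (hk : IsCoefficient Ω k) (p q : FieldPair Ω) :
    cForm k p q = ∑ j, ∫ x in Ω, k x * (p.2 j x * q.2 j x) := by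
  simp_rw [cForm, Finset.mul_sum]
  exact integral_finsetSum _ fun j _ => hk.integrable_mul _ _

lemma cForm_comm (k : Space d → ℝ) (p q : FieldPair Ω) : cForm k p q = cForm k q p := by
  simp_rw [cForm, mul_comm]

lemma IsCoefficient.cForm_add_left (hk : IsCoefficient Ω k) (p p' q : FieldPair Ω) :
    cForm k (p + p') q = cForm k p q + cForm k p' q := by
  simp_rw [hk.cForm_eq_sum, ← Finset.sum_add_distrib]
  refine Finset.sum_congr rfl fun j _ => ?_
  rw [← integral_add (hk.integrable_mul _ _) (hk.integrable_mul _ _)]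
  refine integral_congr_ae ?_
  filter_upwards [Lp.coeFn_add (p.2 j) (p'.2 j)] with x hx
  simp only [Prod.snd_add, Pi.add_apply] at hx ⊢
  rw [hx]
  ring

lemma IsCoefficient.cForm_smul_left (hk : IsCoefficient Ω k) (c : ℝ) (p q : FieldPair Ω) :
    cForm k (c • p) q = c * cForm k p q := by
  simp_rw [hk.cForm_eq_sum, Finset.mul_sum]
  refine Finset.sum_congr rfl fun j _ => ?_
  rw [← integral_const_mul]
  refine integral_congr_ae ?_
  filter_upwards [Lp.coeFn_smul c (p.2 j)] with x hx
  change k x * ((c • p.2 j : L2 Ω) x * q.2 j x) = _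
  rw [hx, Pi.smul_apply, smul_eq_mul]
  ring

lemma IsCoefficient.mul_gradNormSq_le (hk : IsCoefficient Ω k) {c : ℝ} (hc : ∀ x ∈ Ω, c ≤ k x)
    (q : FieldPair Ω) : c * gradNormSq q ≤ cForm k q q := by
  rw [hk.cForm_eq_sum, gradNormSq, Finset.mul_sum]
  refine Finset.sum_le_sum fun j _ => ?_
  rw [← real_inner_self_eq_norm_sq, inner_L2_eq, ← integral_const_mul]
  refine integral_mono_ae ((integrable_mul_L2 _ _).const_mul c) (hk.integrable_mul _ _) ?_
  filter_upwards [ae_restrict_mem hk.measurableSet] with x hx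
  exact mul_le_mul_of_nonneg_right (hc x hx) (mul_self_nonneg _)

end Dirichlet

/-! ### Eigenvalues of preconditioned saddle-point matrices -/

section Saddle

lemma cauchySchwarz_mulVec {ι : Type*} [Fintype ι] {M : Matrix ι ι ℝ}
    (hM : M.IsSymm) (h : ∀ v, 0 ≤ v ⬝ᵥ (M *ᵥ v)) (u v : ι → ℝ) :
    (v ⬝ᵥ (M *ᵥ u)) ^ 2 ≤ (u ⬝ᵥ (M *ᵥ u)) * (v ⬝ᵥ (M *ᵥ v)) := by
  classical
  have := (Matrix.toBilin' M).apply_sq_le_of_symm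
    (fun x => by simpa [Matrix.toBilin'_apply'] using h x)
    ⟨fun x y => by
      simp only [Matrix.toBilin'_apply', RingHom.id_apply]
      rw [Matrix.dotProduct_mulVec, ← Matrix.mulVec_transpose, hM.eq, dotProduct_comm]⟩ v u
  simp only [Matrix.toBilin'_apply'] at this
  linarith

lemma SpectralBounds.le_and_le {n : ℕ} {Y Z : Matrix (Fin n) (Fin n) ℝ} {lo up : ℝ}
    (h : SpectralBounds Y Z lo up) (hZ : Z.PosDef) (v : Fin n → ℝ) :
    lo * (v ⬝ᵥ (Z *ᵥ v)) ≤ v ⬝ᵥ (Y *ᵥ v) ∧ v ⬝ᵥ (Y *ᵥ v) ≤ up * (v ⬝ᵥ (Z *ᵥ v)) := by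
  rcases eq_or_ne v 0 with rfl | hv
  · simp
  · have hpos : 0 < v ⬝ᵥ (Z *ᵥ v) := by simpa using hZ.dotProduct_mulVec_pos hv
    have := h v hv
    rwa [le_div_iff₀ hpos, div_le_iff₀ hpos] at this

/-- The inequalities between the blocks of a saddle-point matrix `[[A, Bᵀ], [B, -C]]`, the blocks of
a preconditioner `diag(P, T)` and a mass matrix `Q` from which the eigenvalue bounds follow. Here
`κ` is the coercivity constant of `C`, and `cu` and `σ` are the continuity and inf-sup constants
of `B`, measured in the norms of `Q` and `A`. -/
structure SaddleBounds {n m : ℕ} (A P : Matrix (Fin n) (Fin n) ℝ) (B : Matrix (Fin m) (Fin n) ℝ)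
    (C Q T : Matrix (Fin m) (Fin m) ℝ) (δ Δ γ Γ κ cu σ : ℝ) : Prop where
  A_symm : A.IsSymm
  P_posDef : P.PosDef
  T_posDef : T.PosDef
  δ_pos : 0 < δ
  Δ_pos : 0 < Δ
  γ_pos : 0 < γ
  Γ_pos : 0 < Γ
  one_le_cu : 1 ≤ cu
  σ_pos : 0 < σ
  A_bounds : ∀ v, δ * (v ⬝ᵥ (P *ᵥ v)) ≤ v ⬝ᵥ (A *ᵥ v) ∧ v ⬝ᵥ (A *ᵥ v) ≤ Δ * (v ⬝ᵥ (P *ᵥ v))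
  QC_bounds : ∀ q, γ * (q ⬝ᵥ (T *ᵥ q)) ≤ q ⬝ᵥ (Q *ᵥ q) + q ⬝ᵥ (C *ᵥ q) ∧
    q ⬝ᵥ (Q *ᵥ q) + q ⬝ᵥ (C *ᵥ q) ≤ Γ * (q ⬝ᵥ (T *ᵥ q))
  Q_nonneg : ∀ q, 0 ≤ q ⬝ᵥ (Q *ᵥ q)
  C_nonneg : ∀ q, 0 ≤ q ⬝ᵥ (C *ᵥ q)
  C_coercive : ∀ q, κ * (q ⬝ᵥ (Q *ᵥ q)) ≤ q ⬝ᵥ (C *ᵥ q)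
  B_continuous : ∀ q v, (q ⬝ᵥ (B *ᵥ v)) ^ 2 ≤ cu * (q ⬝ᵥ (Q *ᵥ q)) * (v ⬝ᵥ (A *ᵥ v))
  B_infSup : ∀ q, q ≠ 0 → ∃ v, v ≠ 0 ∧
    σ * (q ⬝ᵥ (Q *ᵥ q)) * (v ⬝ᵥ (A *ᵥ v)) ≤ (q ⬝ᵥ (B *ᵥ v)) ^ 2

namespace SaddleBounds

variable {n m : ℕ} {A P : Matrix (Fin n) (Fin n) ℝ} {B : Matrix (Fin m) (Fin n) ℝ}
  {C Q T : Matrix (Fin m) (Fin m) ℝ} {δ Δ γ Γ κ cu σ : ℝ}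

lemma P_nonneg (h : SaddleBounds A P B C Q T δ Δ γ Γ κ cu σ) (v : Fin n → ℝ) :
    0 ≤ v ⬝ᵥ (P *ᵥ v) := by simpa using h.P_posDef.posSemidef.dotProduct_mulVec_nonneg v

lemma T_pos (h : SaddleBounds A P B C Q T δ Δ γ Γ κ cu σ) {q : Fin m → ℝ} (hq : q ≠ 0) :
    0 < q ⬝ᵥ (T *ᵥ q) := by simpa using h.T_posDef.dotProduct_mulVec_pos hq

lemma P_pos (h : SaddleBounds A P B C Q T δ Δ γ Γ κ cu σ) {v : Fin n → ℝ} (hv : v ≠ 0) :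
    0 < v ⬝ᵥ (P *ᵥ v) := by simpa using h.P_posDef.dotProduct_mulVec_pos hv

lemma A_pos (h : SaddleBounds A P B C Q T δ Δ γ Γ κ cu σ) {v : Fin n → ℝ} (hv : v ≠ 0) :
    0 < v ⬝ᵥ (A *ᵥ v) := (mul_pos h.δ_pos (h.P_pos hv)).trans_le (h.A_bounds v).1

lemma A_nonneg (h : SaddleBounds A P B C Q T δ Δ γ Γ κ cu σ) (v : Fin n → ℝ) :
    0 ≤ v ⬝ᵥ (A *ᵥ v) := (mul_nonneg h.δ_pos.le (h.P_nonneg v)).trans (h.A_bounds v).1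

/-- An eigenpair, split into blocks and tested with the eigenvector `(u, p)` itself. -/
lemma exists_of_isGenEigenvalue {lam : ℝ}
    (hlam : IsGenEigenvalue (Matrix.fromBlocks A Bᵀ B (-C)) (blockPrec P T) lam) :
    ∃ (u : Fin n → ℝ) (p : Fin m → ℝ), (u ≠ 0 ∨ p ≠ 0) ∧
      (∀ v, v ⬝ᵥ (A *ᵥ u) + p ⬝ᵥ (B *ᵥ v) = lam * (v ⬝ᵥ (P *ᵥ u))) ∧
      p ⬝ᵥ (B *ᵥ u) - p ⬝ᵥ (C *ᵥ p) = lam * (p ⬝ᵥ (T *ᵥ p)) := by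
  obtain ⟨x, hx, hK⟩ := hlam
  obtain ⟨u, p, rfl⟩ : ∃ u p, x = Sum.elim u p :=
    ⟨x ∘ Sum.inl, x ∘ Sum.inr, (Sum.elim_comp_inl_inr x).symm⟩
  rw [blockPrec, Matrix.fromBlocks_mulVec, Matrix.fromBlocks_mulVec] at hK
  simp only [Sum.elim_comp_inl, Sum.elim_comp_inr] at hK
  have h1 : A *ᵥ u + Bᵀ *ᵥ p = lam • (P *ᵥ u) := by
    funext i; simpa using congrFun hK (Sum.inl i)
  have h2 : B *ᵥ u - C *ᵥ p = lam • (T *ᵥ p) := by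
    funext i; simpa [Matrix.neg_mulVec, sub_eq_add_neg] using congrFun hK (Sum.inr i)
  refine ⟨u, p, ?_, fun v => ?_, ?_⟩
  · by_contra! hc
    exact hx (by rw [hc.1, hc.2]; funext i; cases i <;> rfl)
  · have := congrArg (v ⬝ᵥ ·) h1
    simpa [dotProduct_add, Matrix.dotProduct_mulVec p B v, Matrix.mulVec_transpose,
      dotProduct_comm v] using this
  · have := congrArg (p ⬝ᵥ ·) h2
    simpa [dotProduct_sub] using this

/-- The pressure of an eigenvector for `lam ≤ 0` is nonzero, as `A - lam P` is definite. -/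
lemma pressure_ne_zero (h : SaddleBounds A P B C Q T δ Δ γ Γ κ cu σ) {lam : ℝ} (hlam : lam ≤ 0)
    {u : Fin n → ℝ} {p : Fin m → ℝ} (hup : u ≠ 0 ∨ p ≠ 0)
    (h1 : ∀ v, v ⬝ᵥ (A *ᵥ u) + p ⬝ᵥ (B *ᵥ v) = lam * (v ⬝ᵥ (P *ᵥ u))) : p ≠ 0 := by
  rintro rfl
  have hu : u ≠ 0 := by simpa using hup
  have h1u := h1 u
  rw [zero_dotProduct, add_zero] at h1u
  nlinarith [h.A_pos hu, h.P_pos hu]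

/-- For `lam ≤ 0` the pressure Schur complement of `A - lam P` is bounded below by means of the
inf-sup condition and `A - lam P ≤ (1 - lam / δ) A`. -/
lemma schur_lower (h : SaddleBounds A P B C Q T δ Δ γ Γ κ cu σ) {lam : ℝ} (hlam : lam ≤ 0)
    {u : Fin n → ℝ} {p : Fin m → ℝ} (hp : p ≠ 0)
    (h1 : ∀ v, v ⬝ᵥ (A *ᵥ u) + p ⬝ᵥ (B *ᵥ v) = lam * (v ⬝ᵥ (P *ᵥ u))) :
    δ * (σ * (p ⬝ᵥ (Q *ᵥ p))) ≤ (δ - lam) * -(p ⬝ᵥ (B *ᵥ u)) := by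
  obtain ⟨v, hv, hinf⟩ := h.B_infSup p hp
  have hP : P.IsSymm := by simpa [Matrix.IsHermitian, Matrix.IsSymm] using h.P_posDef.1
  have hM : (A - lam • P).IsSymm := h.A_symm.sub (hP.smul lam)
  have hMv (x y : Fin n → ℝ) : x ⬝ᵥ ((A - lam • P) *ᵥ y) =
      x ⬝ᵥ (A *ᵥ y) - lam * (x ⬝ᵥ (P *ᵥ y)) := by
    simp [Matrix.sub_mulVec, Matrix.smul_mulVec, dotProduct_sub, dotProduct_smul]
  have hM0 (x : Fin n → ℝ) : 0 ≤ x ⬝ᵥ ((A - lam • P) *ᵥ x) := by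
    rw [hMv]
    nlinarith [h.A_nonneg x, h.P_nonneg x]
  have hcs := cauchySchwarz_mulVec hM hM0 u v
  have huM : u ⬝ᵥ ((A - lam • P) *ᵥ u) = -(p ⬝ᵥ (B *ᵥ u)) := by
    rw [hMv]; linarith [h1 u]
  have hvM : v ⬝ᵥ ((A - lam • P) *ᵥ u) = -(p ⬝ᵥ (B *ᵥ v)) := by
    rw [hMv]; linarith [h1 v]
  have hβ := hM0 u
  rw [huM] at hcs hβ
  rw [hvM, hMv v v, neg_sq] at hcs
  have hAv := h.A_pos hv
  have hPA : δ * (v ⬝ᵥ (A *ᵥ v) - lam * (v ⬝ᵥ (P *ᵥ v))) ≤ (δ - lam) * (v ⬝ᵥ (A *ᵥ v)) := by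
    nlinarith [(h.A_bounds v).1]
  have := mul_le_mul_of_nonneg_left hPA hβ
  refine le_of_mul_le_mul_right ?_ hAv
  nlinarith [mul_le_mul_of_nonneg_left (hinf.trans hcs) h.δ_pos.le]

/-- A constant `cl ≤ 1` with `cl (1 + κ) ≤ σ + κ` satisfies `cl (Q + C) ≤ σ Q + C`: the part
`(1 - cl) C ≥ (1 - cl) κ Q` makes up for what `σ Q` may lack. -/
lemma schur_total_lower (h : SaddleBounds A P B C Q T δ Δ γ Γ κ cu σ) {cl : ℝ} (hcl0 : 0 ≤ cl)
    (hcl1 : cl ≤ 1) (hcl : cl * (1 + κ) ≤ σ + κ) (q : Fin m → ℝ) :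
    cl * (γ * (q ⬝ᵥ (T *ᵥ q))) ≤ σ * (q ⬝ᵥ (Q *ᵥ q)) + q ⬝ᵥ (C *ᵥ q) := by
  have h1 := mul_le_mul_of_nonneg_left (h.QC_bounds q).1 hcl0
  have h2 := mul_le_mul_of_nonneg_right hcl (h.Q_nonneg q)
  have h3 := mul_le_mul_of_nonneg_left (h.C_coercive q) (sub_nonneg.2 hcl1)
  linarith

theorem ne_zero (h : SaddleBounds A P B C Q T δ Δ γ Γ κ cu σ) {lam : ℝ}
    (hev : IsGenEigenvalue (Matrix.fromBlocks A Bᵀ B (-C)) (blockPrec P T) lam) : lam ≠ 0 := by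
  rintro rfl
  obtain ⟨u, p, hup, h1, h2⟩ := exists_of_isGenEigenvalue hev
  have hp := h.pressure_ne_zero le_rfl hup h1
  have h3 := h.schur_lower le_rfl hp h1
  have h1u := h1 u
  rw [zero_mul] at h1u h2
  have hT := h.T_pos hp
  have hC := h.C_nonneg p
  have hQ := h.Q_nonneg p
  have hA := h.A_nonneg u
  have hβ : p ⬝ᵥ (B *ᵥ u) = 0 := by linarith
  have hC0 : p ⬝ᵥ (C *ᵥ p) = 0 := by linarith
  rw [hβ, neg_zero, mul_zero] at h3
  have hQ0 : p ⬝ᵥ (Q *ᵥ p) ≤ 0 := by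
    by_contra! hc
    exact absurd h3 (not_le.2 (mul_pos h.δ_pos (mul_pos h.σ_pos hc)))
  have := (h.QC_bounds p).1
  linarith [mul_pos h.γ_pos hT]

theorem neg_bounds (h : SaddleBounds A P B C Q T δ Δ γ Γ κ cu σ) {cl : ℝ} (hcl0 : 0 ≤ cl)
    (hcl1 : cl ≤ 1) (hcl : cl * (1 + κ) ≤ σ + κ) {lam : ℝ}
    (hev : IsGenEigenvalue (Matrix.fromBlocks A Bᵀ B (-C)) (blockPrec P T) lam) (hlam : lam < 0) :
    -(cu * Γ) ≤ lam ∧ lam ≤ 1 / 2 * (δ - √(δ ^ 2 + 4 * cl * γ * δ)) := by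
  obtain ⟨u, p, hup, h1, h2⟩ := exists_of_isGenEigenvalue hev
  have hp := h.pressure_ne_zero hlam.le hup h1
  have h3 := h.schur_lower hlam.le hp h1
  have h1u := h1 u
  have hB := h.B_continuous p u
  have hT := h.T_pos hp
  have hC := h.C_nonneg p
  have hQ := h.Q_nonneg p
  have hA := h.A_nonneg u
  have hP := h.P_nonneg u
  have hS := h.schur_total_lower hcl0 hcl1 hcl p
  have hQC := (h.QC_bounds p).2
  have hcu := h.one_le_cu
  have hδ := h.δ_pos
  generalize p ⬝ᵥ (B *ᵥ u) = β at *
  generalize p ⬝ᵥ (C *ᵥ p) = c at *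
  generalize p ⬝ᵥ (T *ᵥ p) = t at *
  generalize p ⬝ᵥ (Q *ᵥ p) = q at *
  generalize u ⬝ᵥ (A *ᵥ u) = a at *
  generalize u ⬝ᵥ (P *ᵥ u) = π at *
  have hβa : a ≤ -β := by nlinarith
  constructor
  · have hβq : -β ≤ cu * q := by
      rcases (hA.trans hβa).eq_or_lt with h0 | h0
      · rw [← h0]; positivity
      · refine le_of_mul_le_mul_right ?_ h0
        calc -β * -β = β ^ 2 := by ring
          _ ≤ cu * q * a := hB
          _ ≤ cu * q * -β := mul_le_mul_of_nonneg_left hβa (by positivity)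
    have hcc : c ≤ cu * c := le_mul_of_one_le_left hC hcu
    have := mul_le_mul_of_nonneg_left hQC (zero_le_one.trans hcu)
    refine le_of_mul_le_mul_right ?_ hT
    linarith
  · -- The eigenvalue satisfies `lam² - δ lam - cl γ δ ≥ 0`.
    have hquad : cl * γ * δ ≤ lam ^ 2 - δ * lam := by
      refine le_of_mul_le_mul_right ?_ hT
      have hct : (δ - lam) * (c - β) = (lam ^ 2 - δ * lam) * t := by
        rw [← neg_sub β c, h2]; ring
      have := mul_le_mul_of_nonneg_left hS hδ.le
      have := mul_nonneg (neg_nonneg.2 hlam.le) hC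
      linarith
    have : √(δ ^ 2 + 4 * cl * γ * δ) ≤ δ - 2 * lam := by
      rw [Real.sqrt_le_left (by linarith)]
      linarith
    linarith

theorem pos_bounds (h : SaddleBounds A P B C Q T δ Δ γ Γ κ cu σ) {lam : ℝ}
    (hev : IsGenEigenvalue (Matrix.fromBlocks A Bᵀ B (-C)) (blockPrec P T) lam) (hlam : 0 < lam) :
    δ ≤ lam ∧ lam ≤ Δ + cu * Γ := by
  obtain ⟨u, p, hup, h1, h2⟩ := exists_of_isGenEigenvalue hev
  have hu : u ≠ 0 := by
    rintro rfl
    have hp : p ≠ 0 := by simpa using hup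
    rw [Matrix.mulVec_zero, dotProduct_zero] at h2
    linarith [mul_pos hlam (h.T_pos hp), h.C_nonneg p]
  have hT0 : 0 ≤ p ⬝ᵥ (T *ᵥ p) := by
    simpa using h.T_posDef.posSemidef.dotProduct_mulVec_nonneg p
  have h1u := h1 u
  have hB := h.B_continuous p u
  have hC := h.C_nonneg p
  have hQ := h.Q_nonneg p
  have hA := h.A_pos hu
  have hP := h.P_pos hu
  have hAP := h.A_bounds u
  have hQC := (h.QC_bounds p).2
  have hcu := h.one_le_cu
  have hΔ := h.Δ_pos
  have hΓ := h.Γ_pos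
  generalize p ⬝ᵥ (B *ᵥ u) = β at *
  generalize p ⬝ᵥ (C *ᵥ p) = c at *
  generalize p ⬝ᵥ (T *ᵥ p) = t at *
  generalize p ⬝ᵥ (Q *ᵥ p) = q at *
  generalize u ⬝ᵥ (A *ᵥ u) = a at *
  generalize u ⬝ᵥ (P *ᵥ u) = π at *
  have ht : 0 ≤ lam * t := mul_nonneg hlam.le hT0
  constructor
  · refine le_of_mul_le_mul_right ?_ hP
    linarith [hAP.1]
  · have hcu0 : 0 < cu := zero_lt_one.trans_le hcu
    have hβ : lam * β ≤ cu * Γ * a := by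
      rcases (show 0 ≤ β by linarith).eq_or_lt with h0 | h0
      · rw [← h0, mul_zero]; positivity
      · refine le_of_mul_le_mul_right ?_ h0
        have e1 : cu * q * a ≤ cu * (Γ * t) * a := by gcongr; linarith
        have e2 : lam * (cu * (Γ * t) * a) ≤ cu * Γ * a * β := by
          have := mul_le_mul_of_nonneg_left (show lam * t ≤ β by linarith)
            (show 0 ≤ cu * Γ * a by positivity)
          linarith
        have e3 := mul_le_mul_of_nonneg_left (hB.trans e1) hlam.le
        linarith
    -- Hence `lam² ≤ Δ (lam + cu Γ)`.
    have hquad : lam ^ 2 ≤ Δ * (lam + cu * Γ) := by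
      refine le_of_mul_le_mul_right ?_ hP
      have := mul_le_mul_of_nonneg_left hAP.2 (show 0 ≤ lam + cu * Γ by positivity)
      have e : lam * (a + β) = lam * (lam * π) := by rw [h1u]
      linarith
    by_contra! hc
    have := mul_pos hcu0 hΓ
    nlinarith

end SaddleBounds

end Saddle

/-! ### Convergence of preconditioned MINRES -/

section Minres

variable {ι : Type*} [Fintype ι] [DecidableEq ι]

/-- One factor `1 - θ M²` of the residual polynomial; on eigenvectors of a Hermitian matrix `M` it
acts as a number of modulus at most `ρ`. -/
lemma norm_sub_sq_mulVec_le {M : Matrix ι ι ℝ} (hM : M.IsHermitian) {θ ρ : ℝ}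
    (hρ : ∀ i, |1 - θ * hM.eigenvalues i ^ 2| ≤ ρ) (y : ι → ℝ) :
    ‖WithLp.toLp 2 (y - θ • (M *ᵥ (M *ᵥ y)))‖ ^ 2 ≤ ρ ^ 2 * ‖WithLp.toLp 2 y‖ ^ 2 := by
  let e := hM.eigenvectorBasis
  have hcoef (i : ι) (y : ι → ℝ) : inner ℝ (e i) (WithLp.toLp 2 (M *ᵥ y)) =
      hM.eigenvalues i * inner ℝ (e i) (WithLp.toLp 2 y) := by
    have hMt : Mᵀ = M := by simpa [Matrix.IsHermitian] using hM
    rw [EuclideanSpace.inner_eq_star_dotProduct, EuclideanSpace.inner_eq_star_dotProduct]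
    simp only [star_trivial]
    rw [dotProduct_comm, Matrix.dotProduct_mulVec, ← Matrix.mulVec_transpose, hMt,
      hM.mulVec_eigenvectorBasis, smul_dotProduct, smul_eq_mul, dotProduct_comm]
  rw [← e.sum_sq_norm_inner_right, ← e.sum_sq_norm_inner_right, Finset.mul_sum]
  refine Finset.sum_le_sum fun i _ => ?_
  have : inner ℝ (e i) (WithLp.toLp 2 (y - θ • (M *ᵥ (M *ᵥ y)))) =
      (1 - θ * hM.eigenvalues i ^ 2) * inner ℝ (e i) (WithLp.toLp 2 y) := by
    rw [WithLp.toLp_sub, WithLp.toLp_smul, inner_sub_right, real_inner_smul_right, hcoef, hcoef]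
    ring
  rw [this, norm_mul, mul_pow, Real.norm_eq_abs]
  gcongr
  exact hρ i

open scoped MatrixOrder in
lemma exists_sqrt_of_posDef {Z : Matrix ι ι ℝ} (hZ : Z.PosDef) :
    ∃ b : Matrix ι ι ℝ, IsUnit b ∧ b.IsHermitian ∧ Z = b * b := by
  have h : IsStrictlyPositive Z := Matrix.isStrictlyPositive_iff_posDef.2 hZ
  obtain ⟨b, hbu, hbs, hZb⟩ :=
    CStarAlgebra.isStrictlyPositive_iff_exists_isUnit_and_isSelfAdjoint_and_eq_mul_self.1 h
  exact ⟨b, hbu, hbs, hZb⟩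

variable {K Z : Matrix ι ι ℝ}

lemma krylov_mono (K Z : Matrix ι ι ℝ) (r : ι → ℝ) {m n : ℕ} (h : m ≤ n) :
    krylov K Z r m ≤ krylov K Z r n := by
  refine Submodule.span_mono ?_
  rintro _ ⟨j, rfl⟩
  exact ⟨⟨j, j.2.trans_le h⟩, rfl⟩

lemma mulVec_mem_krylov_one (K Z : Matrix ι ι ℝ) (r : ι → ℝ) : Z⁻¹ *ᵥ r ∈ krylov K Z r 1 :=
  Submodule.subset_span ⟨0, by simp⟩

lemma mulVec_mem_krylov_succ (K Z : Matrix ι ι ℝ) (r : ι → ℝ) {m : ℕ} {w : ι → ℝ}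
    (hw : w ∈ krylov K Z r m) : (Z⁻¹ * K) *ᵥ w ∈ krylov K Z r (m + 1) := by
  have : krylov K Z r m ≤ (krylov K Z r (m + 1)).comap (Z⁻¹ * K).mulVecLin := by
    refine Submodule.span_le.2 ?_
    rintro _ ⟨j, rfl⟩
    refine Submodule.subset_span ⟨j.succ, ?_⟩
    simp [pow_succ', Matrix.mulVec_mulVec, Matrix.mul_assoc]
  exact this hw

/-- The residual polynomial `(1 - θ t²)^k` is realised in the Krylov space of dimension `2 k`. -/
lemma exists_mem_krylov_residual (K Z : Matrix ι ι ℝ) (θ : ℝ) (r : ι → ℝ) (k : ℕ) :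
    ∃ w ∈ krylov K Z r (2 * k), r - K *ᵥ w =
      (fun y => y - θ • ((K * Z⁻¹) *ᵥ ((K * Z⁻¹) *ᵥ y)))^[k] r := by
  induction k with
  | zero => exact ⟨0, Submodule.zero_mem _, by simp⟩
  | succ k ih =>
    obtain ⟨w, hw, hr⟩ := ih
    rw [Function.iterate_succ_apply', ← hr]
    refine ⟨w + θ • ((Z⁻¹ * K) *ᵥ (Z⁻¹ *ᵥ r - (Z⁻¹ * K) *ᵥ w)), ?_, ?_⟩
    · refine Submodule.add_mem _ (krylov_mono K Z r (by omega) hw) (Submodule.smul_mem _ _ ?_)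
      refine mulVec_mem_krylov_succ K Z r (m := 2 * k + 1) (Submodule.sub_mem _ ?_ ?_)
      · exact krylov_mono K Z r (by omega) (mulVec_mem_krylov_one K Z r)
      · exact mulVec_mem_krylov_succ K Z r hw
    · simp only [Matrix.mulVec_add, Matrix.mulVec_smul, Matrix.mulVec_sub, Matrix.mulVec_mulVec,
        Matrix.mul_assoc]
      abel

/-- The convergence bound for MINRES when the eigenvalues of the preconditioned matrix have moduli
in `[lo, up]`: the residual polynomial `(1 - t² / up²)^k` is an admissible competitor. -/
theorem IsMinresIterate.precNorm_le (hK : K.IsHermitian) (hZ : Z.PosDef) {lo up : ℝ}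
    (hlo : 0 < lo) (hlu : lo ≤ up)
    (hev : ∀ lam, IsGenEigenvalue K Z lam → lo ≤ |lam| ∧ |lam| ≤ up)
    {f x₀ x : ι → ℝ} {m k : ℕ} (hkm : 2 * k ≤ m) (hx : IsMinresIterate K Z f x₀ m x) :
    precNorm Z (f - K *ᵥ x) ≤ (1 - lo ^ 2 / up ^ 2) ^ k * precNorm Z (f - K *ᵥ x₀) := by
  -- With `Z = b²` and `s = b⁻¹`, the matrix `M = s K s` is Hermitian and `‖r‖_{Z⁻¹} = ‖s r‖`.
  obtain ⟨b, hbu, hbs, hZb⟩ := exists_sqrt_of_posDef hZ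
  have hdet : IsUnit b.det := (Matrix.isUnit_iff_isUnit_det b).1 hbu
  set s := b⁻¹ with hs
  have hsH : s.IsHermitian := hbs.inv
  have hsT : sᵀ = s := by simpa [Matrix.IsHermitian] using hsH
  have hbsone : b * s = 1 := Matrix.mul_nonsing_inv b hdet
  have hZinv : Z⁻¹ = s * s := by rw [hZb, Matrix.mul_inv_rev]
  have hnorm (r : ι → ℝ) : precNorm Z r = ‖WithLp.toLp 2 (s *ᵥ r)‖ := by
    rw [precNorm, hZinv, ← Matrix.mulVec_mulVec, Matrix.dotProduct_mulVec,
      ← Matrix.mulVec_transpose, hsT, EuclideanSpace.norm_eq]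
    simp [dotProduct, sq]
  have hM : (s * K * s).IsHermitian := by
    rw [Matrix.IsHermitian, Matrix.conjTranspose_mul, Matrix.conjTranspose_mul, hsH.eq, hK.eq,
      Matrix.mul_assoc]
  have hup : 0 < up := hlo.trans_le hlu
  have heig (i : ι) : |1 - 1 / up ^ 2 * hM.eigenvalues i ^ 2| ≤ 1 - lo ^ 2 / up ^ 2 := by
    have hgen : IsGenEigenvalue K Z (hM.eigenvalues i) := by
      have hv := hM.mulVec_eigenvectorBasis i
      refine ⟨s *ᵥ ⇑(hM.eigenvectorBasis i), fun h0 => ?_, ?_⟩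
      · have h1 : (⇑(hM.eigenvectorBasis i) : ι → ℝ) = 0 := by
          simpa [Matrix.mulVec_mulVec, hbsone] using congrArg (b *ᵥ ·) h0
        refine hM.eigenvectorBasis.toBasis.ne_zero i ?_
        ext j
        simpa using congrFun h1 j
      · have := congrArg (b *ᵥ ·) hv
        simp only [Matrix.mulVec_mulVec, Matrix.mulVec_smul, ← Matrix.mul_assoc, hbsone,
          Matrix.one_mul] at this
        have hZs : Z * s = b := by rw [hZb, Matrix.mul_assoc, hbsone, Matrix.mul_one]
        rw [Matrix.mulVec_mulVec, this, Matrix.mulVec_mulVec, hZs]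
    obtain ⟨h1, h2⟩ := hev _ hgen
    have h1' : lo ^ 2 ≤ hM.eigenvalues i ^ 2 := by
      rw [← sq_abs (hM.eigenvalues i)]; gcongr
    have h2' : hM.eigenvalues i ^ 2 ≤ up ^ 2 := by
      rw [← sq_abs (hM.eigenvalues i)]; gcongr
    rw [one_div_mul_eq_div, abs_of_nonneg]
    · gcongr
    · rw [sub_nonneg, div_le_one (by positivity)]
      exact h2'
  have hρ : 0 ≤ 1 - lo ^ 2 / up ^ 2 := by
    rw [sub_nonneg, div_le_one (by positivity)]
    gcongr
  obtain ⟨w, hw, hr⟩ := exists_mem_krylov_residual K Z (1 / up ^ 2) (f - K *ᵥ x₀) k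
  have hmin := hx.minimal (x₀ + w) (by
    rw [add_sub_cancel_left]
    exact krylov_mono K Z _ hkm hw)
  refine hmin.trans ?_
  rw [Matrix.mulVec_add, ← sub_sub, hr]
  clear hmin hr hw
  induction k with
  | zero => simp
  | succ k ih =>
    rw [Function.iterate_succ_apply', pow_succ' (1 - lo ^ 2 / up ^ 2), mul_assoc]
    refine le_trans ?_ (mul_le_mul_of_nonneg_left (ih (by omega)) hρ)
    generalize (fun y => y - (1 / up ^ 2) • ((K * Z⁻¹) *ᵥ ((K * Z⁻¹) *ᵥ y)))^[k] _ = y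
    rw [hnorm, hnorm]
    refine (sq_le_sq₀ (norm_nonneg _) (mul_nonneg hρ (norm_nonneg _))).1 ?_
    rw [mul_pow]
    have hsy : s *ᵥ (y - (1 / up ^ 2) • ((K * Z⁻¹) *ᵥ ((K * Z⁻¹) *ᵥ y))) =
        s *ᵥ y - (1 / up ^ 2) • ((s * K * s) *ᵥ ((s * K * s) *ᵥ (s *ᵥ y))) := by
      simp only [Matrix.mulVec_sub, Matrix.mulVec_smul, Matrix.mulVec_mulVec, hZinv,
        Matrix.mul_assoc]
    rw [hsy]
    exact norm_sub_sq_mulVec_le hM heig (s *ᵥ y)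

lemma blockPrec_posDef {n m : ℕ} {P : Matrix (Fin n) (Fin n) ℝ} {T : Matrix (Fin m) (Fin m) ℝ}
    (hP : P.PosDef) (hT : T.PosDef) : (blockPrec P T).PosDef := by
  refine Matrix.PosDef.of_dotProduct_mulVec_pos
    (Matrix.IsHermitian.fromBlocks hP.1 (by simp) hT.1) fun x hx => ?_
  obtain ⟨u, p, rfl⟩ : ∃ u p, x = Sum.elim u p :=
    ⟨x ∘ Sum.inl, x ∘ Sum.inr, (Sum.elim_comp_inl_inr x).symm⟩
  rw [blockPrec, Matrix.fromBlocks_mulVec, star_trivial]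
  simp only [Sum.elim_comp_inl, Sum.elim_comp_inr, sumElim_dotProduct_sumElim,
    Matrix.zero_mulVec, add_zero, zero_add]
  have hu0 : 0 ≤ u ⬝ᵥ (P *ᵥ u) := by simpa using hP.posSemidef.dotProduct_mulVec_nonneg u
  have hp0 : 0 ≤ p ⬝ᵥ (T *ᵥ p) := by simpa using hT.posSemidef.dotProduct_mulVec_nonneg p
  rcases ne_or_eq u 0 with hu | rfl
  · exact add_pos_of_pos_of_nonneg (by simpa using hP.dotProduct_mulVec_pos hu) hp0
  · refine add_pos_of_nonneg_of_pos hu0 ?_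
    have hp : p ≠ 0 := by
      rintro rfl
      exact hx (by funext i; cases i <;> rfl)
    simpa using hT.dotProduct_mulVec_pos hp

end Minres

/-! ### The matrices of a discretisation -/

lemma dotProduct_gram_mulVec {V W : Type*} [AddCommGroup V] [Module ℝ V] [AddCommGroup W]
    [Module ℝ W] {n m : ℕ} (F : V →ₗ[ℝ] W →ₗ[ℝ] ℝ) (b : Fin n → V) (c : Fin m → W)
    (x : Fin n → ℝ) (y : Fin m → ℝ) :
    x ⬝ᵥ (Matrix.of (fun i j => F (b i) (c j)) *ᵥ y) =
      F (∑ i, x i • b i) (∑ j, y j • c j) := by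
  simp only [dotProduct, Matrix.mulVec, Matrix.of_apply, map_sum, LinearMap.sum_apply, map_smul,
    LinearMap.smul_apply, smul_eq_mul, Finset.mul_sum]
  rw [Finset.sum_comm]
  exact Finset.sum_congr rfl fun j _ => Finset.sum_congr rfl fun i _ => by ring

section Bilinear

variable {d : ℕ} {Ω : Set (Space d)}

lemma divergence_add (u v : VectorField Ω) :
    divergence (u + v) = divergence u + divergence v := by
  simp [divergence, Finset.sum_add_distrib]

lemma divergence_smul (c : ℝ) (v : VectorField Ω) :
    divergence (c • v) = c • divergence v := by
  simp [divergence, Finset.smul_sum]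

lemma strain_add (u v : VectorField Ω) (i j : Fin d) :
    strain (u + v) i j = strain u i j + strain v i j := by
  simp only [strain, Pi.add_apply, Prod.snd_add, smul_add]
  abel

lemma strain_smul (c : ℝ) (v : VectorField Ω) (i j : Fin d) :
    strain (c • v) i j = c • strain v i j := by
  simp only [strain, Pi.smul_apply, Prod.smul_snd, smul_add, smul_comm c]

lemma aForm_comm (α : ℝ) (u v : VectorField Ω) : aForm α u v = aForm α v u := by
  simp [aForm, real_inner_comm]

/-- `aForm` as a bilinear map. -/
noncomputable def aBilin (Ω : Set (Space d)) (α : ℝ) :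
    VectorField Ω →ₗ[ℝ] VectorField Ω →ₗ[ℝ] ℝ :=
  LinearMap.mk₂ ℝ (aForm α)
    (fun u u' v => by
      simp only [aForm, strain_add, divergence_add, inner_add_left, Finset.sum_add_distrib]; ring)
    (fun c u v => by
      simp only [aForm, strain_smul, divergence_smul, real_inner_smul_left, ← Finset.mul_sum,
        smul_eq_mul]; ring)
    (fun u v v' => by
      simp only [aForm, strain_add, divergence_add, inner_add_right, Finset.sum_add_distrib]; ring)
    (fun c u v => by
      simp only [aForm, strain_smul, divergence_smul, real_inner_smul_right, ← Finset.mul_sum,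
        smul_eq_mul]; ring)

/-- `bForm` as a bilinear map. -/
noncomputable def bBilin (Ω : Set (Space d)) : FieldPair Ω →ₗ[ℝ] VectorField Ω →ₗ[ℝ] ℝ :=
  LinearMap.mk₂ ℝ bForm
    (fun p p' v => by simp only [bForm, Prod.fst_add, inner_add_left]; ring)
    (fun c p v => by simp only [bForm, Prod.smul_fst, real_inner_smul_left, smul_eq_mul]; ring)
    (fun p v v' => by simp only [bForm, divergence_add, inner_add_right]; ring)
    (fun c p v => by simp only [bForm, divergence_smul, real_inner_smul_right, smul_eq_mul]; ring)

/-- `cForm` as a bilinear map. -/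
noncomputable def IsCoefficient.cBilin {k : Space d → ℝ} (hk : IsCoefficient Ω k) :
    FieldPair Ω →ₗ[ℝ] FieldPair Ω →ₗ[ℝ] ℝ :=
  LinearMap.mk₂ ℝ (cForm k) hk.cForm_add_left hk.cForm_smul_left
    (fun p q q' => by simp only [cForm_comm k p, hk.cForm_add_left])
    (fun c p q => by simp only [cForm_comm k p, hk.cForm_smul_left, smul_eq_mul])

/-- The `L²` inner product of the functions underlying two pairs, as a bilinear map. -/
noncomputable def massBilin (Ω : Set (Space d)) : FieldPair Ω →ₗ[ℝ] FieldPair Ω →ₗ[ℝ] ℝ :=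
  (innerₗ (L2 Ω)).compl₁₂ (LinearMap.fst ℝ _ _) (LinearMap.fst ℝ _ _)

end Bilinear

namespace Discretisation

variable {d : ℕ} (D : Discretisation d)

lemma isCoefficient : IsCoefficient D.Ω D.k :=
  ⟨D.isOpen.measurableSet, D.k_measurable, D.k_nonneg, D.k_bounded⟩

/-- The velocity field with coordinate vector `x`. -/
noncomputable def velocity (x : Fin D.nu → ℝ) : VectorField D.Ω :=
  ∑ i, x i • (D.basisX i : VectorField D.Ω)

/-- The pressure with coordinate vector `p`. -/
noncomputable def pressure (p : Fin D.np → ℝ) : FieldPair D.Ω :=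
  ∑ i, p i • (D.basisM i : FieldPair D.Ω)

lemma velocity_eq (x : Fin D.nu → ℝ) :
    D.velocity x = (D.basisX.equivFun.symm x : VectorField D.Ω) := by
  simp [velocity, Module.Basis.equivFun_symm_apply]

lemma pressure_eq (p : Fin D.np → ℝ) :
    D.pressure p = (D.basisM.equivFun.symm p : FieldPair D.Ω) := by
  simp [pressure, Module.Basis.equivFun_symm_apply]

lemma velocity_mem_H10 (x : Fin D.nu → ℝ) (i : Fin d) : D.velocity x i ∈ H10 D.Ω := by
  rw [velocity_eq]
  exact D.X_le _ (Subtype.mem _) i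

lemma pressure_mem (p : Fin D.np → ℝ) : D.pressure p ∈ D.M := by
  rw [pressure_eq]
  exact Subtype.mem _

lemma pressure_ne_zero {p : Fin D.np → ℝ} (hp : p ≠ 0) : D.pressure p ≠ 0 := by
  rw [pressure_eq, Ne, ZeroMemClass.coe_eq_zero, EmbeddingLike.map_eq_zero_iff]
  exact hp

lemma exists_velocity_eq {v : VectorField D.Ω} (hv : v ∈ D.X) : ∃ x, D.velocity x = v :=
  ⟨D.basisX.equivFun ⟨v, hv⟩, by rw [velocity_eq, LinearEquiv.symm_apply_apply]⟩

lemma dotProduct_A_mulVec (α : ℝ) (x y : Fin D.nu → ℝ) :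
    x ⬝ᵥ (D.A α *ᵥ y) = aForm α (D.velocity x) (D.velocity y) :=
  dotProduct_gram_mulVec (aBilin D.Ω α) _ _ x y

lemma dotProduct_B_mulVec (p : Fin D.np → ℝ) (x : Fin D.nu → ℝ) :
    p ⬝ᵥ (D.B *ᵥ x) = bForm (D.pressure p) (D.velocity x) :=
  dotProduct_gram_mulVec (bBilin D.Ω) _ _ p x

lemma dotProduct_C_mulVec (p q : Fin D.np → ℝ) :
    p ⬝ᵥ (D.C *ᵥ q) = cForm D.k (D.pressure p) (D.pressure q) :=
  dotProduct_gram_mulVec D.isCoefficient.cBilin _ _ p q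

lemma dotProduct_Q_mulVec_self (p : Fin D.np → ℝ) :
    p ⬝ᵥ (D.Q *ᵥ p) = ‖(D.pressure p).1‖ ^ 2 :=
  (dotProduct_gram_mulVec (massBilin D.Ω) _ _ p p).trans
    (real_inner_self_eq_norm_sq (D.pressure p).1)

lemma A_isSymm (α : ℝ) : (D.A α).IsSymm :=
  Matrix.IsSymm.ext fun _ _ => aForm_comm α _ _

lemma C_isSymm : D.C.IsSymm :=
  Matrix.IsSymm.ext fun _ _ => cForm_comm _ _ _

lemma saddle_isHermitian (α : ℝ) : (D.saddle α).IsHermitian := by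
  refine Matrix.IsHermitian.fromBlocks ?_ ?_ ?_
  · simpa [Matrix.IsHermitian, Matrix.IsSymm] using D.A_isSymm α
  · simp
  · simpa [Matrix.IsHermitian, Matrix.IsSymm] using D.C_isSymm

end Discretisation

/-- The constant `c_q` is the largest `cl ≤ 1` for which `cl (1 + κ) ≤ σ + κ`, where
`σ = c₁² / (1 + |α|)` and `κ = cP kLow`. -/
lemma cLower_mul_le {α kLow c₁ cP : ℝ} (hk : 0 ≤ kLow) (hcP : 0 < cP) :
    cLower α kLow c₁ cP * (1 + cP * kLow) ≤ c₁ ^ 2 / (1 + |α|) + cP * kLow := by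
  have h1 : 0 < 1 + |α| := by positivity
  have h2 : 0 < 1 + cP * kLow := by positivity
  calc cLower α kLow c₁ cP * (1 + cP * kLow)
      ≤ (c₁ ^ 2 + cP * kLow * (1 + |α|)) / ((1 + |α|) * (1 + cP * kLow)) * (1 + cP * kLow) :=
        mul_le_mul_of_nonneg_right (min_le_left _ _) h2.le
    _ = c₁ ^ 2 / (1 + |α|) + cP * kLow := by field_simp

lemma cLower_pos {α kLow c₁ cP : ℝ} (hk : 0 ≤ kLow) (hc₁ : 0 < c₁) (hcP : 0 < cP) :
    0 < cLower α kLow c₁ cP := by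
  have h1 : 0 < 1 + |α| := by positivity
  exact lt_min (by positivity) one_pos

theorem Admissible.saddleBounds {d : ℕ} {D : Discretisation d}
    {α kLow c₁ cP lowAP upAP lowQT upQT : ℝ}
    {P : Matrix (Fin D.nu) (Fin D.nu) ℝ} {T : Matrix (Fin D.np) (Fin D.np) ℝ}
    (h : Admissible D α kLow c₁ cP P T lowAP upAP lowQT upQT)
    (hα : -1 < α) (hk : 0 ≤ kLow) (hc₁ : 0 < c₁)
    (hlowAP : 0 < lowAP) (hupAP : 0 < upAP) (hlowQT : 0 < lowQT) (hupQT : 0 < upQT) :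
    SaddleBounds (D.A α) P D.B D.C D.Q T lowAP upAP lowQT upQT (cP * kLow) (cUpper α)
      (c₁ ^ 2 / (1 + |α|)) := by
  have h1α : 0 < 1 + |α| := by positivity
  have hcoer (q : Fin D.np → ℝ) :
      cP * kLow * ‖(D.pressure q).1‖ ^ 2 ≤ cForm D.k (D.pressure q) (D.pressure q) := by
    obtain ⟨h1, h0⟩ := D.M_le _ (D.pressure_mem q)
    have := mul_le_mul_of_nonneg_left (h.poincare _ h1 h0) hk
    linarith [D.isCoefficient.mul_gradNormSq_le h.k_low (D.pressure q)]
  have hpos (v : Fin D.nu → ℝ) (hv : v ≠ 0) : 0 < v ⬝ᵥ (D.A α *ᵥ v) :=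
    (mul_pos hlowAP (by simpa using h.P_posDef.dotProduct_mulVec_pos hv)).trans_le
      (h.boundsAP.le_and_le h.P_posDef v).1
  exact
    { A_symm := D.A_isSymm α
      P_posDef := h.P_posDef
      T_posDef := h.T_posDef
      δ_pos := hlowAP
      Δ_pos := hupAP
      γ_pos := hlowQT
      Γ_pos := hupQT
      one_le_cu := one_le_cUpper hα
      σ_pos := by positivity
      A_bounds := h.boundsAP.le_and_le h.P_posDef
      QC_bounds := fun q => by
        simpa [Matrix.add_mulVec, dotProduct_add] using h.boundsQT.le_and_le h.T_posDef q
      Q_nonneg := fun q => by rw [D.dotProduct_Q_mulVec_self]; positivity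
      C_nonneg := fun q => by
        rw [D.dotProduct_C_mulVec]
        simpa using D.isCoefficient.mul_gradNormSq_le D.k_nonneg (D.pressure q)
      C_coercive := fun q => by
        rw [D.dotProduct_C_mulVec, D.dotProduct_Q_mulVec_self]
        exact hcoer q
      B_continuous := fun q v => by
        rw [D.dotProduct_B_mulVec, D.dotProduct_Q_mulVec_self, D.dotProduct_A_mulVec]
        exact bForm_sq_le hα _ (D.velocity_mem_H10 v)
      B_infSup := fun q hq => by
        obtain ⟨v, hvX, hv, hb⟩ := h.infSup _ (D.pressure_mem q) (D.pressure_ne_zero hq)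
        obtain ⟨x, rfl⟩ := D.exists_velocity_eq hvX
        refine ⟨x, fun h0 => hv (by simp [h0, Discretisation.velocity]), ?_⟩
        rw [D.dotProduct_B_mulVec, D.dotProduct_Q_mulVec_self, D.dotProduct_A_mulVec]
        have hg : 0 ≤ vecGradNormSq (D.velocity x) :=
          (sq_nonneg _).trans (norm_divergence_sq_le (D.velocity_mem_H10 x))
        have hsq := pow_le_pow_left₀ (by positivity) hb 2
        rw [mul_pow, mul_pow, Real.sq_sqrt hg] at hsq
        refine le_trans ?_ hsq
        calc c₁ ^ 2 / (1 + |α|) * ‖(D.pressure q).1‖ ^ 2 * aForm α (D.velocity x) (D.velocity x)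
            ≤ c₁ ^ 2 / (1 + |α|) * ‖(D.pressure q).1‖ ^ 2 *
                ((1 + |α|) * vecGradNormSq (D.velocity x)) :=
              mul_le_mul_of_nonneg_left (aForm_self_le α (D.velocity_mem_H10 x)) (by positivity)
          _ = c₁ ^ 2 * ‖(D.pressure q).1‖ ^ 2 * vecGradNormSq (D.velocity x) := by field_simp }

end MagmaMantle

theorem mainTheorem1
    (α kLow c₁ cP lowAP upAP lowQT upQT : ℝ)
    (hα₁ : -(1 / 3) ≤ α) (hα₂ : α ≤ 1000) (hk : 0 ≤ kLow) (hc₁ : 0 < c₁) (hcP : 0 < cP)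
    (hlowAP : 0 < lowAP) (hupAP : 0 < upAP) (hlowQT : 0 < lowQT) (hupQT : 0 < upQT) :
    (∀ (d : ℕ), 2 ≤ d → d ≤ 3 → ∀ (D : Discretisation d)
      (P : Matrix (Fin D.nu) (Fin D.nu) ℝ) (T : Matrix (Fin D.np) (Fin D.np) ℝ),
      Admissible D α kLow c₁ cP P T lowAP upAP lowQT upQT →
      ∀ lam : ℝ, IsGenEigenvalue (D.saddle α) (blockPrec P T) lam →
        (lam < 0 →
          -(cUpper α * upQT) ≤ lam ∧
          lam ≤ 1 / 2 * (lowAP -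
            √(lowAP ^ 2 + 4 * cLower α kLow c₁ cP * lowQT * lowAP))) ∧
        (0 < lam → lowAP ≤ lam ∧ lam ≤ upAP + cUpper α * upQT)) ∧
    (∀ tol : ℝ, 0 < tol → ∃ N : ℕ,
      ∀ (d : ℕ), 2 ≤ d → d ≤ 3 → ∀ (D : Discretisation d)
        (P : Matrix (Fin D.nu) (Fin D.nu) ℝ) (T : Matrix (Fin D.np) (Fin D.np) ℝ),
        Admissible D α kLow c₁ cP P T lowAP upAP lowQT upQT →
        ∀ (f x₀ x : Fin D.nu ⊕ Fin D.np → ℝ) (m : ℕ), N ≤ m →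
          IsMinresIterate (D.saddle α) (blockPrec P T) f x₀ m x →
          precNorm (blockPrec P T) (f - D.saddle α *ᵥ x) ≤
            tol * precNorm (blockPrec P T) (f - D.saddle α *ᵥ x₀)) := by
  have hα : -1 < α := by linarith
  have hcl := cLower_pos (α := α) hk hc₁ hcP
  have hcl1 : cLower α kLow c₁ cP ≤ 1 := min_le_right _ _
  have hcle := cLower_mul_le (α := α) (c₁ := c₁) hk hcP
  have hcu : 0 < cUpper α := one_pos.trans_le (one_le_cUpper hα)
  have bounds {d : ℕ} {D : Discretisation d} {P : Matrix (Fin D.nu) (Fin D.nu) ℝ}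
      {T : Matrix (Fin D.np) (Fin D.np) ℝ}
      (h : Admissible D α kLow c₁ cP P T lowAP upAP lowQT upQT) :=
    h.saddleBounds hα hk hc₁ hlowAP hupAP hlowQT hupQT
  refine ⟨fun d _ _ D P T h lam hev => ⟨(bounds h).neg_bounds hcl.le hcl1 hcle hev,
    (bounds h).pos_bounds hev⟩, fun tol htol => ?_⟩
  set g := 1 / 2 * (lowAP - √(lowAP ^ 2 + 4 * cLower α kLow c₁ cP * lowQT * lowAP)) with hg_def
  have hg : g < 0 := by
    have : lowAP < √(lowAP ^ 2 + 4 * cLower α kLow c₁ cP * lowQT * lowAP) :=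
      Real.lt_sqrt_of_sq_lt (by linarith [mul_pos (mul_pos hcl hlowQT) hlowAP])
    linarith
  -- The moduli of the eigenvalues lie in `[lo, up]`; the summand `lo` in `up` ensures `lo < up`
  -- even when there are no eigenvalues.
  set lo := min lowAP (-g) with hlo_def
  have hlo : 0 < lo := lt_min hlowAP (neg_pos.2 hg)
  set up := upAP + cUpper α * upQT + lo with hup_def
  have hcuQ : 0 < cUpper α * upQT := mul_pos hcu hupQT
  have hlu : lo < up := by linarith
  have hρ : 1 - lo ^ 2 / up ^ 2 < 1 := by
    have : 0 < lo ^ 2 / up ^ 2 := by positivity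
    linarith
  have hρ0 : 0 ≤ 1 - lo ^ 2 / up ^ 2 := by
    rw [sub_nonneg, div_le_one (by positivity)]
    gcongr
  obtain ⟨k, hk'⟩ := exists_pow_lt_of_lt_one htol hρ
  refine ⟨2 * k, fun d _ _ D P T h f x₀ x m hm hx => ?_⟩
  refine (hx.precNorm_le (D.saddle_isHermitian α) (blockPrec_posDef h.P_posDef h.T_posDef) hlo
    hlu.le (fun lam hev => ?_) hm).trans
      (mul_le_mul_of_nonneg_right hk'.le (Real.sqrt_nonneg _))
  have hlo1 : lo ≤ lowAP := min_le_left _ _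
  have hlo2 : lo ≤ -g := min_le_right _ _
  rcases ((bounds h).ne_zero hev).lt_or_gt with hneg | hpos
  · obtain ⟨h1, h2⟩ := (bounds h).neg_bounds hcl.le hcl1 hcle hev hneg
    rw [abs_of_neg hneg]
    constructor <;> linarith
  · obtain ⟨h1, h2⟩ := (bounds h).pos_bounds hev hpos
    rw [abs_of_pos hpos]
    constructor <;> linarith
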